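/- Throughout, a polytope is the convex hull of a finite set of points in some $\mathbb{R}^d$. A facet of a polytope $R$ is a non-empty face of $R$ of dimension $\dim R - 1$ (in particular, a single point has no facets). For a non-empty polytope $P$, the linear extension complexity $\operatorname{xc}(P)$ is the smallest number of facets of any polytope (in any $\mathbb{R}^k$) that can be mapped onto $P$ by an affine map. A polytope $P \subseteq \mathbb{R}^d$ is called a pyramid if there are a set $B \subseteq \mathbb{R}^d$ (the base) and a point $v \in \mathbb{R}^d$ (the apex) not contained in the affine hull of $B$ such that $P = \operatorname{conv}(B \cup \{v\})$. Theorem. Let $P \subseteq \mathbb{R}^m$ and $Q \subseteq \mathbb{R}^n$ be non-empty polytopes such that at least one of the two is a pyramid. Then $$\operatorname{xc}(P \times Q) = \operatorname{xc}(P) + \operatorname{xc}(Q).$$ -/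

import Mathlib

/-- A polytope: the convex hull of a finite set of points (the empty set is allowed). -/
def IsPolytope {E : Type*} [AddCommGroup E] [Module ℝ E] (P : Set E) : Prop :=
  ∃ s : Finset E, P = convexHull ℝ (s : Set E)

/-- `P` is a pyramid: the convex hull of a base `B` and an apex `v` that is not contained in the
affine hull of `B`. -/
def IsPyramid {E : Type*} [AddCommGroup E] [Module ℝ E] (P : Set E) : Prop :=
  ∃ (B : Set E) (v : E), P = convexHull ℝ (B ∪ {v}) ∧ v ∉ affineSpan ℝ B

/-- The facets of a polytope `R` in `ℝ^k`: the non-empty faces (maximizer sets of linear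
functionals) whose dimension is one less than the dimension of `R`. The dimension of a non-empty
set is that of the direction of its affine hull. A single point has no facets. -/
def facets {k : ℕ} (R : Set (Fin k → ℝ)) : Set (Set (Fin k → ℝ)) :=
  {F | IsExposed ℝ R F ∧ F.Nonempty ∧
    Module.finrank ℝ (vectorSpan ℝ F) + 1 = Module.finrank ℝ (vectorSpan ℝ R)}

/-- The linear extension complexity of `P`: the smallest number of facets of any polytope `R`
(in any `ℝ^k`) that is mapped onto `P` by an affine map. -/
noncomputable def extensionComplexity {E : Type*} [AddCommGroup E] [Module ℝ E] (P : Set E) : ℕ :=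
  sInf {r : ℕ | ∃ (k : ℕ) (R : Set (Fin k → ℝ)) (π : (Fin k → ℝ) →ᵃ[ℝ] E),
    IsPolytope R ∧ π '' R = P ∧ (facets R).encard = (r : ℕ∞)}

/-! Multiplying extensions gives the upper bound. For the lower bound, let `P` be a pyramid with
apex `v` and base `{a = 0}`, let a polyhedron `R` with `N` inequalities project onto `P × Q`, and
let `I` be the set of inequalities that vanish on the whole fibre over `v`.

Turning the inequalities of `I` into equations keeps that fibre, so the result still maps onto `Q`:
this extension has `N - |I|` inequalities. Near a relative interior point `y` of the fibre only `I`
matters, and `P` is a cone at `v` truncated by `a ≥ 0`; hence `I` together with the pullback of `a ≥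
0` gives an extension of `P` with `|I| + 1` inequalities. One inequality must still be saved.

If some member of `I` vanishes on the fibre over base × `{q}` for a single `q`, it can become an
equation in the extension of `P`: segments from `y` to that fibre already cover `P`. Otherwise some
`j ∉ I` vanishes over the entire base, and `R ∩ {ℓ j = 0}` with all of `I` dropped still has image
`Q`, since over base × `{q}` the inequalities of `I` are strict at relative interior points. This is
`HasPolyhedralExtension.exists_add_eq_of_isPyramidWith`.

The polyhedra so obtained may be unbounded, so the argument counts inequalities rather than facets.
`HasPolyhedralExtension.exists_polytope` and `IsPolytope.hasPolyhedralExtension_image` translate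
between the two counts. -/

/-! ### Polyhedra and their facets -/

/-- The solution set in an affine subspace of a family of affine inequalities. -/
def polyhedron {V ι : Type*} [AddCommGroup V] [Module ℝ V] (A : AffineSubspace ℝ V)
    (ℓ : ι → V →ᵃ[ℝ] ℝ) : Set V :=
  {x | x ∈ A ∧ ∀ i, 0 ≤ ℓ i x}

theorem convex_polyhedron {V ι : Type*} [AddCommGroup V] [Module ℝ V] (A : AffineSubspace ℝ V)
    (ℓ : ι → V →ᵃ[ℝ] ℝ) : Convex ℝ (polyhedron A ℓ) := by
  have : polyhedron A ℓ = (A : Set V) ∩ ⋂ i, (ℓ i) ⁻¹' Set.Ici 0 := by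
    ext x; simp [polyhedron]
  rw [this]
  exact A.convex.inter (convex_iInter fun i => (convex_Ici (0 : ℝ)).affine_preimage (ℓ i))

theorem apply_lineMap_real {V : Type*} [AddCommGroup V] [Module ℝ V] (f : V →ᵃ[ℝ] ℝ)
    (y x : V) (t : ℝ) : f (AffineMap.lineMap y x t) = (1 - t) * f y + t * f x := by
  rw [AffineMap.apply_lineMap, AffineMap.lineMap_apply_ring]

/-- Finitely many affine functionals that are nonnegative on a convex set are simultaneously
positive at a suitable point of it, except those that vanish on the whole set. -/
theorem Convex.exists_forall_pos {V ι : Type*} [AddCommGroup V] [Module ℝ V] [Finite ι]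
    {S : Set V} (hS : Convex ℝ S) (hne : S.Nonempty) (ℓ : ι → V →ᵃ[ℝ] ℝ)
    (h0 : ∀ x ∈ S, ∀ i, 0 ≤ ℓ i x) :
    ∃ y ∈ S, ∀ i, (∃ x ∈ S, 0 < ℓ i x) → 0 < ℓ i y := by
  classical
  have := Fintype.ofFinite ι
  suffices h : ∀ s : Finset ι, ∃ y ∈ S, ∀ i ∈ s, (∃ x ∈ S, 0 < ℓ i x) → 0 < ℓ i y by
    simpa using h Finset.univ
  intro s
  induction s using Finset.induction_on with
  | empty => exact ⟨hne.some, hne.some_mem, by simp⟩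
  | insert j s _ ih =>
    obtain ⟨y, hy, hpos⟩ := ih
    by_cases hj : ∃ x ∈ S, 0 < ℓ j x
    · obtain ⟨x, hx, hxj⟩ := hj
      have hm : ∀ i, ℓ i (AffineMap.lineMap y x (1 / 2 : ℝ)) = (ℓ i y + ℓ i x) / 2 := by
        intro i; rw [apply_lineMap_real]; ring
      refine ⟨AffineMap.lineMap y x (1 / 2 : ℝ),
        hS.lineMap_mem hy hx ⟨by norm_num, by norm_num⟩, fun i hi hex => ?_⟩
      rw [hm]
      rcases Finset.mem_insert.1 hi with rfl | hi
      · linarith [h0 y hy i]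
      · linarith [h0 x hx i, hpos i hi hex]
    · refine ⟨y, hy, fun i hi hex => ?_⟩
      rcases Finset.mem_insert.1 hi with rfl | hi
      · exact absurd hex hj
      · exact hpos i hi hex

/-- Moving slightly from a point of a polyhedron, in a direction allowed by the inequalities
active at the point, one stays in the polyhedron. -/
theorem exists_forall_lineMap_mem_polyhedron {V ι : Type*} [AddCommGroup V] [Module ℝ V] [Finite ι]
    {A : AffineSubspace ℝ V} {ℓ : ι → V →ᵃ[ℝ] ℝ} {y x : V} (hy : y ∈ polyhedron A ℓ)
    (hx : x ∈ A) :
    ∃ δ : ℝ, 0 < δ ∧ δ ≤ 1 ∧ ∀ t : ℝ, |t| ≤ δ → (∀ i, ℓ i y = 0 → 0 ≤ t * ℓ i x) →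
      AffineMap.lineMap y x t ∈ polyhedron A ℓ := by
  have hev : ∀ᶠ t in nhds (0 : ℝ), ∀ i, 0 < ℓ i y → 0 < (1 - t) * ℓ i y + t * ℓ i x := by
    refine Filter.eventually_all.2 fun i => ?_
    by_cases hi : 0 < ℓ i y
    · have hc : Continuous fun t : ℝ => (1 - t) * ℓ i y + t * ℓ i x := by fun_prop
      have := hc.continuousAt (x := 0) |>.eventually (lt_mem_nhds (a := 0) (by simpa using hi))
      filter_upwards [this] with t ht _ using ht
    · exact Filter.Eventually.of_forall fun t h => absurd h hi
  obtain ⟨ε, hε, h⟩ := Metric.eventually_nhds_iff.1 hev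
  refine ⟨min (ε / 2) 1, by positivity, min_le_right _ _, fun t ht hact => ?_⟩
  refine ⟨AffineMap.lineMap_mem t hy.1 hx, fun i => ?_⟩
  rw [apply_lineMap_real]
  rcases (hy.2 i).eq_or_lt with h0 | h0
  · rw [← h0]; simpa using hact i h0.symm
  · refine (h ?_ i h0).le
    rw [Real.dist_eq, sub_zero]
    have := ht.trans (min_le_left _ _)
    linarith

theorem AffineMap.linear_eq_zero_of_mem_vectorSpan {V : Type*} [AddCommGroup V] [Module ℝ V]
    (f : V →ᵃ[ℝ] ℝ) {S : Set V} {c : ℝ} (h : ∀ x ∈ S, f x = c) {d : V}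
    (hd : d ∈ vectorSpan ℝ S) : f.linear d = 0 := by
  have : vectorSpan ℝ S ≤ LinearMap.ker f.linear := by
    rw [vectorSpan_def, Submodule.span_le]
    rintro _ ⟨x, hx, y, hy, rfl⟩
    change f.linear (x -ᵥ y) = 0
    rw [AffineMap.linearMap_vsub, h x hx, h y hy, vsub_self]
  exact this hd

/-- Each facet of a polyhedron is cut out by one of the inequalities. -/
theorem exists_eq_of_mem_facets {k : ℕ} {ι : Type*} [Finite ι] {A : AffineSubspace ℝ (Fin k → ℝ)}
    {ℓ : ι → (Fin k → ℝ) →ᵃ[ℝ] ℝ} {F : Set (Fin k → ℝ)} (hF : F ∈ facets (polyhedron A ℓ)) :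
    ∃ i, {x ∈ polyhedron A ℓ | ℓ i x = 0} = F := by
  obtain ⟨hexp, hne, hdim⟩ := hF
  obtain ⟨l, hl⟩ := hexp hne
  have hsub : F ⊆ polyhedron A ℓ := hexp.subset
  have hFc : Convex ℝ F := hexp.convex (convex_polyhedron A ℓ)
  -- `y` plays the role of a relative interior point of `F`: an inequality active at `y` is active
  -- on all of `F`.
  obtain ⟨y, hy, hpos⟩ := hFc.exists_forall_pos hne ℓ fun x hx => (hsub hx).2
  have hyR := hsub hy
  have hmax : ∀ x ∈ polyhedron A ℓ, l x ≤ l y := by rw [hl] at hy; exact hy.2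
  have hmem : ∀ x ∈ polyhedron A ℓ, l y ≤ l x → x ∈ F := by
    intro x hx hyx; rw [hl]; exact ⟨hx, fun z hz => (hmax z hz).trans hyx⟩
  have heq : ∀ x ∈ F, l x = l y := by
    intro x hx; rw [hl] at hx; exact le_antisymm (hmax x hx.1) (hx.2 y hyR)
  -- If every inequality active at `y` vanished on the polyhedron, one could step from `y` directly
  -- away from any `x`; maximality of `l` at `y` would then force `F` to be everything.
  obtain ⟨i, hiy, x₀, hx₀, hix₀⟩ : ∃ i, ℓ i y = 0 ∧ ∃ x ∈ polyhedron A ℓ, 0 < ℓ i x := by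
    by_contra! hcon
    have : F = polyhedron A ℓ := by
      refine hsub.antisymm fun x hx => hmem x hx ?_
      obtain ⟨δ, hδ, _, h⟩ := exists_forall_lineMap_mem_polyhedron hyR hx.1
      have hz := hmax _ (h (-δ) (by rw [abs_neg, abs_of_pos hδ]) fun i hi => by
        rw [le_antisymm (hcon i hi x hx) (hx.2 i), mul_zero])
      have := apply_lineMap_real (l : (Fin k → ℝ) →ₗ[ℝ] ℝ).toAffineMap y x (-δ)
      simp only [LinearMap.coe_toAffineMap, ContinuousLinearMap.coe_coe] at this
      rw [this] at hz
      nlinarith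
    rw [this] at hdim; omega
  have hvan : ∀ x ∈ F, ℓ i x = 0 := by
    intro x hx
    by_contra hc
    exact (hpos i ⟨x, hx, lt_of_le_of_ne ((hsub hx).2 i) (Ne.symm hc)⟩).ne' hiy
  refine ⟨i, ?_⟩
  set G := {x ∈ polyhedron A ℓ | ℓ i x = 0} with hG
  have hFG : F ⊆ G := fun x hx => ⟨hsub hx, hvan x hx⟩
  have hlt : vectorSpan ℝ G < vectorSpan ℝ (polyhedron A ℓ) := by
    refine lt_of_le_of_ne (vectorSpan_mono ℝ fun x hx => hx.1) fun he => ?_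
    have hd : x₀ -ᵥ y ∈ vectorSpan ℝ G := he ▸ vsub_mem_vectorSpan ℝ hx₀ hyR
    have := (ℓ i).linear_eq_zero_of_mem_vectorSpan (S := G) (c := 0) (fun x hx => hx.2) hd
    rw [AffineMap.linearMap_vsub, hiy] at this
    simp at this; linarith
  have hle : vectorSpan ℝ F ≤ vectorSpan ℝ G := vectorSpan_mono ℝ hFG
  -- The dimension of `G` is below that of the polyhedron and at least that of `F`, which is only
  -- one less. So the spans agree, and `l` is constant on `G`.
  have hspan : vectorSpan ℝ F = vectorSpan ℝ G := by
    refine Submodule.eq_of_le_of_finrank_le hle ?_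
    have := Submodule.finrank_lt_finrank_of_lt hlt
    omega
  refine Set.Subset.antisymm (fun x hx => hmem x hx.1 ?_) hFG
  have hd : x -ᵥ y ∈ vectorSpan ℝ F := hspan ▸ vsub_mem_vectorSpan ℝ hx (hFG hy)
  have := (l : (Fin k → ℝ) →ₗ[ℝ] ℝ).toAffineMap.linear_eq_zero_of_mem_vectorSpan
    (S := F) (c := l y) (by simpa using heq) hd
  simp at this; linarith

theorem encard_facets_polyhedron_le {k : ℕ} {ι : Type*} [Fintype ι]
    (A : AffineSubspace ℝ (Fin k → ℝ)) (ℓ : ι → (Fin k → ℝ) →ᵃ[ℝ] ℝ) :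
    (facets (polyhedron A ℓ)).encard ≤ Fintype.card ι := by
  have hsub : facets (polyhedron A ℓ) ⊆
      Set.range fun i => {x ∈ polyhedron A ℓ | ℓ i x = 0} := fun F hF => exists_eq_of_mem_facets hF
  refine (Set.encard_le_encard hsub).trans ?_
  rw [← Set.image_univ]
  refine (Set.encard_image_le _ _).trans ?_
  simp

/-- If a segment starts in a closed set and ends outside, it has a last point in the set. -/
theorem IsClosed.exists_last_lineMap_mem {E : Type*} [AddCommGroup E] [Module ℝ E]
    [TopologicalSpace E] [IsTopologicalAddGroup E] [ContinuousSMul ℝ E] {S : Set E}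
    (hS : IsClosed S) {y x : E} (hy : y ∈ S) (hx : x ∉ S) :
    ∃ t : ℝ, 0 ≤ t ∧ t < 1 ∧ AffineMap.lineMap y x t ∈ S ∧
      ∀ u, t < u → u ≤ 1 → AffineMap.lineMap y x u ∉ S := by
  have hc : Continuous fun t : ℝ => (AffineMap.lineMap y x t : E) := by
    simp only [AffineMap.lineMap_apply_module]; fun_prop
  have hK : IsCompact (Set.Icc (0 : ℝ) 1 ∩ (fun t : ℝ => (AffineMap.lineMap y x t : E)) ⁻¹' S) :=
    isCompact_Icc.inter_right (hS.preimage hc)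
  obtain ⟨t, ⟨ht, htS⟩, hmax⟩ := hK.exists_isGreatest ⟨0, by simp, by simpa using hy⟩
  refine ⟨t, ht.1, lt_of_le_of_ne ht.2 ?_, htS, fun u hu hu1 huS => ?_⟩
  · rintro rfl
    exact hx (by simpa using htS)
  · exact absurd (hmax ⟨⟨ht.1.trans hu.le, hu1⟩, huS⟩) (not_le.2 hu)

/-! ### Extensions by possibly unbounded polyhedra -/

/-- `P` is an affine image of a possibly unbounded polyhedron with `N` inequalities. -/
def HasPolyhedralExtension {E : Type*} [AddCommGroup E] [Module ℝ E] (P : Set E) (N : ℕ) : Prop :=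
  ∃ (V : Type) (_ : AddCommGroup V) (_ : Module ℝ V) (A : AffineSubspace ℝ V)
    (ℓ : Fin N → V →ᵃ[ℝ] ℝ) (π : V →ᵃ[ℝ] E), π '' polyhedron A ℓ = P

theorem HasPolyhedralExtension.of_fintype {E : Type*} [AddCommGroup E] [Module ℝ E] {P : Set E}
    {N : ℕ} {V : Type} [AddCommGroup V] [Module ℝ V] {ι : Type*} [Fintype ι]
    (A : AffineSubspace ℝ V) (ℓ : ι → V →ᵃ[ℝ] ℝ) (π : V →ᵃ[ℝ] E) (h : π '' polyhedron A ℓ = P)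
    (hN : Fintype.card ι ≤ N) : HasPolyhedralExtension P N := by
  classical
  let e := Fintype.equivFin ι
  -- Surplus indices carry the trivial inequality `0 ≤ 0`.
  refine ⟨V, _, _, A, fun j => if hj : (j : ℕ) < Fintype.card ι then ℓ (e.symm ⟨j, hj⟩) else 0, π,
    ?_⟩
  rw [← h]
  congr 1
  ext x
  refine and_congr_right fun _ => ⟨fun hx i => ?_, fun hx j => ?_⟩
  · have := hx ⟨e i, (e i).2.trans_le hN⟩
    simpa using this
  · dsimp only
    split_ifs with hj
    · exact hx _
    · simp

theorem LinearMap.exists_comp_eq_of_ker_le {D X E : Type*} [AddCommGroup D] [Module ℝ D]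
    [AddCommGroup X] [Module ℝ X] [AddCommGroup E] [Module ℝ E] (f : D →ₗ[ℝ] X) (g : D →ₗ[ℝ] E)
    (h : LinearMap.ker f ≤ LinearMap.ker g) : ∃ φ : X →ₗ[ℝ] E, ∀ d, φ (f d) = g d := by
  obtain ⟨s, hs⟩ := ((LinearMap.ker f).liftQ f le_rfl).exists_leftInverse_of_injective
    (Submodule.ker_liftQ_eq_bot _ _ _ le_rfl)
  refine ⟨(LinearMap.ker f).liftQ g h ∘ₗ s, fun d => ?_⟩
  have := LinearMap.congr_fun hs ((LinearMap.ker f).mkQ d)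
  simp only [LinearMap.comp_apply, Submodule.mkQ_apply, Submodule.liftQ_apply, LinearMap.id_apply]
    at this
  simp [this]

/-! ### Affine slices of the orthant -/

/-- The coordinate functionals on `ι → ℝ`. -/
def coordFunctional {ι : Type*} (i : ι) : (ι → ℝ) →ᵃ[ℝ] ℝ :=
  (LinearMap.proj i : (ι → ℝ) →ₗ[ℝ] ℝ).toAffineMap

@[simp]
theorem coordFunctional_apply {ι : Type*} (i : ι) (x : ι → ℝ) : coordFunctional i x = x i := rfl

theorem isClosed_polyhedron_coordFunctional {N : ℕ} (A : AffineSubspace ℝ (Fin N → ℝ)) :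
    IsClosed (polyhedron A coordFunctional) := by
  have : polyhedron A coordFunctional = (A : Set (Fin N → ℝ)) ∩ ⋂ i, {x | 0 ≤ x i} := by
    ext x; simp [polyhedron]
  rw [this]
  exact A.closed_of_finiteDimensional.inter
    (isClosed_iInter fun i => isClosed_le continuous_const (continuous_apply i))

/-- An extreme point of the intersection of an affine subspace with the orthant is determined by
its zero coordinates. -/
theorem finite_extremePoints_polyhedron {N : ℕ} (A : AffineSubspace ℝ (Fin N → ℝ)) :
    ((polyhedron A coordFunctional).extremePoints ℝ).Finite := by
  refine Set.Finite.of_finite_image (f := fun x : Fin N → ℝ => {i | x i = 0}) (Set.toFinite _) ?_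
  intro x hx y hy hxy
  have hz : ∀ i, x i = 0 → y i = 0 := fun i hi => (Set.ext_iff.1 hxy i).1 hi
  -- Every coordinate vanishing at `x` also vanishes at `y`, so `x` can be moved both ways along the
  -- line through `y`.
  obtain ⟨δ, hδ, _, h⟩ := exists_forall_lineMap_mem_polyhedron hx.1 hy.1.1
  have h1 := h δ (by rw [abs_of_pos hδ]) fun i hi => by
    rw [coordFunctional_apply, hz i hi, mul_zero]
  have h2 := h (-δ) (by rw [abs_neg, abs_of_pos hδ]) fun i hi => by
    rw [coordFunctional_apply, hz i hi, mul_zero]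
  have hseg : x ∈ openSegment ℝ (AffineMap.lineMap x y δ : Fin N → ℝ) (AffineMap.lineMap x y (-δ)) :=
    ⟨1 / 2, 1 / 2, by norm_num, by norm_num, by norm_num, by
      simp only [AffineMap.lineMap_apply_module]; module⟩
  have := hx.2 h1 h2 hseg
  rw [AffineMap.lineMap_eq_left_iff] at this
  exact this.resolve_right hδ.ne'

theorem isPolytope_polyhedron_of_isBounded {N : ℕ} {A : AffineSubspace ℝ (Fin N → ℝ)}
    (hb : Bornology.IsBounded (polyhedron A coordFunctional)) :
    IsPolytope (polyhedron A coordFunctional) := by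
  have hfin := finite_extremePoints_polyhedron A
  refine ⟨hfin.toFinset, ?_⟩
  rw [Set.Finite.coe_toFinset, ← (hfin.isClosed_convexHull ℝ).closure_eq]
  exact (closure_convexHull_extremePoints
    (Metric.isCompact_of_isClosed_isBounded (isClosed_polyhedron_coordFunctional A) hb)
    (convex_polyhedron _ _)).symm

/-- An unbounded set in finite dimension has a nonzero asymptotic direction. A closed convex set
contains the rays in that direction from its points, so here the direction lies in `A.direction` and
has no negative coordinate. -/
theorem isBounded_polyhedron_coordFunctional {N : ℕ} {A : AffineSubspace ℝ (Fin N → ℝ)}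
    (hne : (polyhedron A coordFunctional).Nonempty)
    (h : ∀ d ∈ A.direction, (∀ i, 0 ≤ d i) → d = 0) :
    Bornology.IsBounded (polyhedron A coordFunctional) := by
  rw [isBounded_iff_asymptoticCone_subset_singleton]
  intro d hd
  obtain ⟨p, hp⟩ := hne
  have key : ∀ t : ℝ, 0 ≤ t → t • d + p ∈ polyhedron A coordFunctional := fun t ht =>
    (convex_polyhedron A _).smul_vadd_mem_of_isClosed_of_mem_asymptoticCone
      (isClosed_polyhedron_coordFunctional A) ht hd hp
  refine h d ?_ fun i => ?_
  · have := A.vsub_mem_direction (key 1 zero_le_one).1 hp.1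
    simpa using this
  · by_contra! hi
    have hpi : 0 ≤ p i := hp.2 i
    have := (key ((p i + 1) / -d i) (div_nonneg (by linarith) (by linarith))).2 i
    simp only [coordFunctional_apply, Pi.add_apply, Pi.smul_apply, smul_eq_mul] at this
    have h2 : (p i + 1) / -d i * d i = -(p i + 1) := by
      field_simp [hi.ne]
    linarith

/-! ### From inequalities to facets -/

/-- A direction of unboundedness of a polyhedron is collapsed by affine maps with bounded image. -/
theorem linear_eq_zero_of_isBounded_image {E : Type*} [NormedAddCommGroup E] [NormedSpace ℝ E]
    {V ι : Type*} [AddCommGroup V] [Module ℝ V] {A : AffineSubspace ℝ V} {ℓ : ι → V →ᵃ[ℝ] ℝ}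
    {π : V →ᵃ[ℝ] E} (hb : Bornology.IsBounded (π '' polyhedron A ℓ))
    (hne : (polyhedron A ℓ).Nonempty) {d : V} (hd : d ∈ A.direction)
    (hpos : ∀ i, 0 ≤ (ℓ i).linear d) : π.linear d = 0 := by
  obtain ⟨x, hx⟩ := hne
  obtain ⟨C, hC⟩ := hb.exists_norm_le
  by_contra hcon
  have hn : 0 < ‖π.linear d‖ := norm_pos_iff.2 hcon
  have key : ∀ t : ℝ, 0 ≤ t → ‖t • π.linear d + π x‖ ≤ C := by
    intro t ht
    have hmem : t • d +ᵥ x ∈ polyhedron A ℓ :=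
      ⟨A.vadd_mem_of_mem_direction (A.direction.smul_mem t hd) hx.1, fun i => by
        rw [AffineMap.map_vadd, map_smul]
        exact add_nonneg (mul_nonneg ht (hpos i)) (hx.2 i)⟩
    have := hC _ ⟨_, hmem, rfl⟩
    rwa [AffineMap.map_vadd, map_smul] at this
  have hC0 : 0 ≤ C := (norm_nonneg _).trans (key 0 le_rfl)
  set t := (C + ‖π x‖ + 1) / ‖π.linear d‖
  have ht : 0 ≤ t := by positivity
  have h1 := key t ht
  have h2 : ‖t • π.linear d‖ ≤ ‖t • π.linear d + π x‖ + ‖π x‖ := by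
    simpa using norm_sub_le (t • π.linear d + π x) (π x)
  rw [norm_smul, Real.norm_of_nonneg ht, div_mul_cancel₀ _ hn.ne'] at h2
  linarith

/-- A bounded affine image of a polyhedron with `N` inequalities is an affine image of a polytope
with at most `N` facets. -/
theorem HasPolyhedralExtension.exists_polytope {E : Type*} [NormedAddCommGroup E]
    [NormedSpace ℝ E] {P : Set E} {N : ℕ} (h : HasPolyhedralExtension P N) (hne : P.Nonempty)
    (hb : Bornology.IsBounded P) :
    ∃ r ≤ N, ∃ (k : ℕ) (R : Set (Fin k → ℝ)) (π : (Fin k → ℝ) →ᵃ[ℝ] E),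
      IsPolytope R ∧ π '' R = P ∧ (facets R).encard = (r : ℕ∞) := by
  classical
  induction N using Nat.strong_induction_on with
  | _ N ih =>
  obtain ⟨V, _, _, A, ℓ, π, hP⟩ := h
  have hRne : (polyhedron A ℓ).Nonempty := by rw [← hP] at hne; exact hne.of_image
  have hcollapse : ∀ d ∈ A.direction, (∀ i, 0 ≤ (ℓ i).linear d) → π.linear d = 0 :=
    fun d hd hpos => linear_eq_zero_of_isBounded_image (hP ▸ hb) hRne hd hpos
  by_cases hrec : ∃ d ∈ A.direction, (∀ i, 0 ≤ (ℓ i).linear d) ∧ ∃ i, 0 < (ℓ i).linear d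
  · obtain ⟨d, hd, hpos, j, hj⟩ := hrec
    have hcard : Fintype.card {i // (ℓ i).linear d = 0} < N := by
      have := Fintype.card_subtype_lt (p := fun i => (ℓ i).linear d = 0) (x := j) hj.ne'
      simpa using this
    -- Inequalities that grow along `d` do not affect the image: a point satisfying the others can
    -- be pushed far along `d`, which `π` collapses, until these hold as well.
    have hext : HasPolyhedralExtension P (Fintype.card {i // (ℓ i).linear d = 0}) := by
      refine .of_fintype A (fun i : {i // (ℓ i).linear d = 0} => ℓ i) π ?_ le_rfl
      rw [← hP]
      refine Set.Subset.antisymm ?_ (Set.image_mono fun x hx => ⟨hx.1, fun i => hx.2 i⟩)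
      rintro _ ⟨x, hx, rfl⟩
      obtain ⟨t, ht⟩ : ∃ t : ℝ, ∀ i, 0 < (ℓ i).linear d → 0 ≤ t * (ℓ i).linear d + ℓ i x := by
        have : ∀ᶠ t : ℝ in Filter.atTop, ∀ i, 0 < (ℓ i).linear d →
            0 ≤ t * (ℓ i).linear d + ℓ i x := by
          refine Filter.eventually_all.2 fun i => ?_
          by_cases hi : 0 < (ℓ i).linear d
          · filter_upwards [Filter.eventually_ge_atTop (-ℓ i x / (ℓ i).linear d)] with t ht _
            rw [div_le_iff₀ hi] at ht
            linarith
          · exact Filter.Eventually.of_forall fun t h => absurd h hi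
        exact this.exists
      refine ⟨t • d +ᵥ x, ⟨A.vadd_mem_of_mem_direction (A.direction.smul_mem t hd) hx.1,
        fun i => ?_⟩, ?_⟩
      · rw [AffineMap.map_vadd, map_smul]
        rcases (hpos i).eq_or_lt with h0 | h0
        · rw [← h0]; simpa using hx.2 ⟨i, h0.symm⟩
        · exact ht i h0
      · rw [AffineMap.map_vadd, map_smul, hcollapse d hd hpos]; simp
    obtain ⟨r, hr, hrest⟩ := ih _ hcard hext
    exact ⟨r, hr.trans hcard.le, hrest⟩
  · push Not at hrec
    obtain ⟨x₀, hx₀⟩ := hRne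
    -- All remaining recession directions are killed by the slack map `L`. Hence its image is
    -- bounded, and `π` factors through it on `A`.
    let L : V →ᵃ[ℝ] (Fin N → ℝ) := AffineMap.pi ℓ
    have hLl : ∀ d i, L.linear d i = (ℓ i).linear d := fun d i => rfl
    obtain ⟨φ, hφ⟩ := (L.linear ∘ₗ A.direction.subtype).exists_comp_eq_of_ker_le
      (π.linear ∘ₗ A.direction.subtype) (by
        intro d hd
        have hd' : L.linear d = 0 := hd
        refine hcollapse d d.2 fun i => ?_
        rw [← hLl, hd']; rfl)
    let π' : (Fin N → ℝ) →ᵃ[ℝ] E :=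
      φ.toAffineMap + AffineMap.const ℝ _ (π x₀ - φ (L x₀))
    have hπ' : ∀ x ∈ A, π' (L x) = π x := by
      intro x hx
      have h1 := hφ ⟨x -ᵥ x₀, A.vsub_mem_direction hx hx₀.1⟩
      simp only [LinearMap.comp_apply, Submodule.subtype_apply, AffineMap.linearMap_vsub] at h1
      simp only [vsub_eq_sub, map_sub] at h1
      simp only [π', AffineMap.coe_add, Pi.add_apply, LinearMap.coe_toAffineMap,
        AffineMap.const_apply]
      rw [sub_eq_iff_eq_add] at h1
      rw [h1]; abel
    have himg : L '' polyhedron A ℓ = polyhedron (A.map L) coordFunctional := by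
      ext w
      constructor
      · rintro ⟨x, hx, rfl⟩
        exact ⟨⟨x, hx.1, rfl⟩, fun i => hx.2 i⟩
      · rintro ⟨⟨x, hx, rfl⟩, hw⟩
        exact ⟨x, ⟨hx, fun i => hw i⟩, rfl⟩
    have hne' : (polyhedron (A.map L) coordFunctional).Nonempty := himg ▸ ⟨_, x₀, hx₀, rfl⟩
    have hbdd : Bornology.IsBounded (polyhedron (A.map L) coordFunctional) := by
      refine isBounded_polyhedron_coordFunctional hne' fun w hw hpos => ?_
      rw [AffineSubspace.map_direction] at hw
      obtain ⟨d, hd, rfl⟩ := hw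
      ext i
      exact le_antisymm (hrec d hd hpos i) (hpos i)
    have hcard := encard_facets_polyhedron_le (A.map L) (coordFunctional (ι := Fin N))
    rw [Fintype.card_fin] at hcard
    obtain ⟨r, hr⟩ := ENat.ne_top_iff_exists.1 (ne_top_of_le_ne_top (ENat.natCast_ne_top N) hcard)
    rw [← hr] at hcard
    refine ⟨r, by exact_mod_cast hcard, N, _, π', isPolytope_polyhedron_of_isBounded hbdd, ?_,
      hr.symm⟩
    rw [← himg, ← hP, Set.image_image]
    exact Set.image_congr fun x hx => hπ' x hx.1

/-! ### From facets to inequalities -/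

theorem IsPolytope.convex {E : Type*} [AddCommGroup E] [Module ℝ E] {P : Set E}
    (h : IsPolytope P) : Convex ℝ P := by
  obtain ⟨s, rfl⟩ := h; exact convex_convexHull ℝ _

theorem IsPolytope.isCompact {E : Type*} [NormedAddCommGroup E] [NormedSpace ℝ E] {P : Set E}
    (h : IsPolytope P) : IsCompact P := by
  obtain ⟨s, rfl⟩ := h; exact s.finite_toSet.isCompact_convexHull ℝ

/-- A polytope has finitely many exposed faces. -/
theorem IsPolytope.finite_isExposed {E : Type*} [NormedAddCommGroup E] [NormedSpace ℝ E] {P : Set E}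
    (h : IsPolytope P) : {F : Set E | IsExposed ℝ P F}.Finite := by
  have hK := h.isCompact
  have hC := h.convex
  obtain ⟨s, hs⟩ := h
  -- A face is the closed convex hull of its extreme points, which are among the finitely many
  -- generators.
  refine Set.Finite.of_finite_image (f := fun F => F.extremePoints ℝ)
    (s.finite_toSet.finite_subsets.subset ?_) ?_
  · rintro _ ⟨F, hF, rfl⟩
    have h1 := (IsExposed.isExtreme hF).extremePoints_subset_extremePoints
    rw [hs] at h1
    exact h1.trans extremePoints_convexHull_subset
  · intro F hF G hG hFG
    have hF' : IsExposed ℝ P F := hF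
    have hG' : IsExposed ℝ P G := hG
    rw [← closure_convexHull_extremePoints (hF'.isCompact hK) (hF'.convex hC),
      ← closure_convexHull_extremePoints (hG'.isCompact hK) (hG'.convex hC)]
    exact congrArg (fun X => closure (convexHull ℝ X)) hFG

open MeasureTheory in
/-- Finitely many proper affine subspaces do not cover a nonempty open set. -/
theorem exists_mem_forall_notMem_affineSubspace {W ι : Type*} [NormedAddCommGroup W]
    [NormedSpace ℝ W] [FiniteDimensional ℝ W] {U : Set W} (hU : IsOpen U) (hne : U.Nonempty)
    {T : Set ι} (hT : T.Finite) (A : ι → AffineSubspace ℝ W) (hA : ∀ i ∈ T, A i ≠ ⊤) :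
    ∃ y ∈ U, ∀ i ∈ T, y ∉ A i := by
  borelize W
  by_contra! hcon
  have hsub : U ⊆ ⋃ i ∈ T, (A i : Set W) := fun y hy => by simpa using hcon y hy
  have h0 : Measure.addHaar (G := W) (⋃ i ∈ T, (A i : Set W)) = 0 :=
    (measure_biUnion_null_iff hT.countable).2 fun i hi => Measure.addHaar_affineSubspace _ _ (hA i hi)
  exact (hU.measure_pos Measure.addHaar hne).ne' (measure_mono_null hsub h0)

/-- A point outside a full-dimensional polytope violates the inequality of some facet. -/
theorem IsPolytope.exists_facet_separating {W : Type*} [NormedAddCommGroup W]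
    [NormedSpace ℝ W] [FiniteDimensional ℝ W] {R : Set W} (hR : IsPolytope R)
    (hint : (interior R).Nonempty) {x : W} (hx : x ∉ R) :
    ∃ F : Set W, IsExposed ℝ R F ∧ F.Nonempty ∧
      Module.finrank ℝ (vectorSpan ℝ F) + 1 = Module.finrank ℝ W ∧
      ∀ g : StrongDual ℝ W, F = {a ∈ R | ∀ b ∈ R, g b ≤ g a} → ∃ z ∈ F, g z < g x := by
  have hcl := hR.isCompact.isClosed
  have hT : {F : Set W | IsExposed ℝ R F ∧ affineSpan ℝ (insert x F) ≠ ⊤}.Finite :=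
    hR.finite_isExposed.subset fun F hF => hF.1
  -- The base point is generic, so that the segment to `x` leaves `R` through a facet and not
  -- through a smaller face.
  obtain ⟨y, hyint, hy⟩ := exists_mem_forall_notMem_affineSubspace isOpen_interior hint hT
    (fun F => affineSpan ℝ (insert x F)) fun F hF => hF.2
  have hyR := interior_subset hyint
  obtain ⟨t, ht0, ht1, hz, hlast⟩ := hcl.exists_last_lineMap_mem hyR hx
  set z := (AffineMap.lineMap y x t : W) with hzdef
  have hzint : z ∉ interior R := by
    intro hzi
    have hc : Continuous fun t : ℝ => (AffineMap.lineMap y x t : W) := by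
      simp only [AffineMap.lineMap_apply_module]; fun_prop
    have hev : ∀ᶠ u in nhdsWithin t (Set.Ioi t), (AffineMap.lineMap y x u : W) ∈ interior R :=
      (hc.continuousAt.eventually (isOpen_interior.mem_nhds hzi)).filter_mono nhdsWithin_le_nhds
    obtain ⟨u, hu, hut⟩ := (hev.and (Ioo_mem_nhdsGT ht1)).exists
    exact hlast u hut.1 hut.2.le (interior_subset hu)
  obtain ⟨f, hf⟩ := geometric_hahn_banach_open_point hR.convex.interior isOpen_interior hzint
  have hfmax : ∀ a ∈ R, f a ≤ f z := by
    have : R ⊆ closure (interior R) := by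
      rw [hR.convex.closure_interior_eq_closure_of_nonempty_interior hint]; exact subset_closure
    intro a ha
    exact closure_minimal (fun b hb => (hf b hb).le) (isClosed_le f.continuous continuous_const)
      (this ha)
  set F := {a ∈ R | ∀ b ∈ R, f b ≤ f a} with hF
  have hzF : z ∈ F := ⟨hz, hfmax⟩
  have hFz : ∀ a ∈ F, f a = f z := fun a ha => le_antisymm (hfmax a ha.1) (ha.2 z hz)
  have hyF : y ∉ F := fun h => (hf y hyint).ne (hFz y h)
  have hexp : IsExposed ℝ R F := fun _ => ⟨f, rfl⟩
  -- The span contains `x` and `z`, hence also `y` on their line; by the choice of `y` it cannot be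
  -- proper.
  have htop : affineSpan ℝ (insert x F) = ⊤ := by
    by_contra hcon
    refine hy F ⟨hexp, hcon⟩ ?_
    have hxA : x ∈ affineSpan ℝ (insert x F) := mem_affineSpan ℝ (Set.mem_insert _ _)
    have hzA : z ∈ affineSpan ℝ (insert x F) := mem_affineSpan ℝ (Set.mem_insert_of_mem _ hzF)
    have : y = AffineMap.lineMap x z (1 / (1 - t)) := by
      have h1 : (1 - t) ≠ 0 := by linarith
      rw [hzdef, AffineMap.lineMap_apply_module, AffineMap.lineMap_apply_module]
      match_scalars
      all_goals field_simp
      ring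
    exact this ▸ AffineMap.lineMap_mem _ hxA hzA
  refine ⟨F, hexp, ⟨z, hzF⟩, ?_, fun g hg => ⟨z, hzF, ?_⟩⟩
  · have h1 : Module.finrank ℝ W ≤ Module.finrank ℝ (vectorSpan ℝ F) + 1 := by
      have := finrank_vectorSpan_insert_le_set ℝ F x
      rwa [← direction_affineSpan, htop, AffineSubspace.direction_top, finrank_top] at this
    have h2 : Module.finrank ℝ (vectorSpan ℝ F) < Module.finrank ℝ W := by
      refine Submodule.finrank_lt fun he => ?_
      have := (f : W →ₗ[ℝ] ℝ).toAffineMap.linear_eq_zero_of_mem_vectorSpan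
        (S := F) (c := f z) (by simpa using hFz) (d := y - z) (he ▸ Submodule.mem_top)
      simp at this
      linarith [hf y hyint]
    omega
  · have hzg : z ∈ {a ∈ R | ∀ b ∈ R, g b ≤ g a} := hg ▸ hzF
    -- Any functional exposing `F` increases strictly from `y` to `z`, hence further on to `x`.
    have hlt : g y < g z := by
      refine lt_of_le_of_ne (hzg.2 y hyR) fun he => hyF ?_
      rw [hg]; exact ⟨hyR, fun b hb => he ▸ hzg.2 b hb⟩
    have := apply_lineMap_real (g : W →ₗ[ℝ] ℝ).toAffineMap y x t
    simp only [LinearMap.coe_toAffineMap, ContinuousLinearMap.coe_coe, ← hzdef] at this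
    nlinarith

theorem IsPolytope.finite_facets {k : ℕ} {R : Set (Fin k → ℝ)} (hR : IsPolytope R) :
    (facets R).Finite :=
  hR.finite_isExposed.subset fun _ hF => hF.1

/-- A polytope is described by its facet inequalities, inside its affine hull. -/
theorem IsPolytope.hasPolyhedralExtension_image {E : Type*} [AddCommGroup E] [Module ℝ E] {k : ℕ}
    {R : Set (Fin k → ℝ)} (hR : IsPolytope R) (hne : R.Nonempty) (π : (Fin k → ℝ) →ᵃ[ℝ] E) :
    HasPolyhedralExtension (π '' R) (facets R).ncard := by
  classical
  obtain ⟨s, hs⟩ := hR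
  have hR : IsPolytope R := ⟨s, hs⟩
  obtain ⟨x₀, hx₀⟩ := hne
  let D := vectorSpan ℝ R
  -- Passing to the direction space of the affine hull makes the polytope full-dimensional.
  let φ : D →ᵃ[ℝ] (Fin k → ℝ) := D.subtype.toAffineMap + AffineMap.const ℝ _ x₀
  have hφ : ∀ d : D, φ d = d + x₀ := fun d => rfl
  have hφl : φ.linear = D.subtype := by simp [φ]
  have hinj : Function.Injective φ := fun a b hab => by
    rw [hφ, hφ, add_left_inj] at hab; exact Subtype.ext hab
  have hrange : R ⊆ Set.range φ := fun x hx =>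
    ⟨⟨x - x₀, vsub_mem_vectorSpan ℝ hx hx₀⟩, by simp [hφ]⟩
  have hsR : (s : Set (Fin k → ℝ)) ⊆ R := hs ▸ subset_convexHull ℝ _
  let R₀ := φ ⁻¹' R
  let s₀ := s.preimage φ hinj.injOn
  have hs₀ : φ '' (s₀ : Set D) = s := by
    rw [Finset.coe_preimage, Set.image_preimage_eq_of_subset (hsR.trans hrange)]
  have hR₀s : R₀ = convexHull ℝ (s₀ : Set D) := by
    rw [← Set.preimage_image_eq (convexHull ℝ (s₀ : Set D)) hinj, AffineMap.image_convexHull, hs₀,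
      ← hs]
  have himg : φ '' R₀ = R := Set.image_preimage_eq_of_subset hrange
  have hx₀₀ : (0 : D) ∈ R₀ := by simpa [R₀, hφ] using hx₀
  have hR₀ : IsPolytope R₀ := ⟨s₀, hR₀s⟩
  have hint : (interior R₀).Nonempty := by
    rw [hR₀s, interior_convexHull_nonempty_iff_affineSpan_eq_top]
    have hs₀ne : (s₀ : Set D).Nonempty := by
      rw [← convexHull_nonempty_iff (𝕜 := ℝ), ← hR₀s]; exact ⟨0, hx₀₀⟩
    rw [AffineSubspace.affineSpan_eq_top_iff_vectorSpan_eq_top_of_nonempty _ _ _ hs₀ne]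
    have h1 := AffineMap.map_vectorSpan φ (s := (s₀ : Set D))
    rw [hs₀, hφl] at h1
    have h2 : vectorSpan ℝ (s : Set (Fin k → ℝ)) = D := by
      rw [← direction_affineSpan, ← affineSpan_convexHull, ← hs, direction_affineSpan]
    rw [h2] at h1
    refine Submodule.map_injective_of_injective D.injective_subtype ?_
    rw [h1, Submodule.map_top, Submodule.range_subtype]
  have hfin := hR.finite_facets
  have := hfin.fintype
  choose g hg using fun F : facets R => F.2.1 F.2.2.1
  choose b hb using fun F : facets R => F.2.2.1
  let ℓ : facets R → D →ᵃ[ℝ] ℝ := fun F =>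
    AffineMap.const ℝ _ (g F (b F)) - ((g F : (Fin k → ℝ) →ₗ[ℝ] ℝ).toAffineMap.comp φ)
  have hℓ : ∀ F d, ℓ F d = g F (b F) - g F (φ d) := fun F d => rfl
  have hgmax : ∀ F, ∀ a ∈ R, g F a ≤ g F (b F) := by
    intro F
    have hbF : b F ∈ {a ∈ R | ∀ c ∈ R, g F c ≤ g F a} := hg F ▸ hb F
    exact hbF.2
  refine .of_fintype ⊤ ℓ (π.comp φ) ?_ (by rw [← Nat.card_coe_set_eq, Nat.card_eq_fintype_card])
  rw [AffineMap.coe_comp, Set.image_comp]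
  congr 1
  refine Eq.trans ?_ himg
  congr 1
  refine Set.Subset.antisymm (fun x hx => ?_) fun x hx => ⟨trivial, fun F => ?_⟩
  · by_contra hxR
    obtain ⟨F₀, hexp, ⟨z₀, hz₀⟩, hdim, hsep⟩ := hR₀.exists_facet_separating hint hxR
    obtain ⟨f, hf⟩ := hexp ⟨z₀, hz₀⟩
    obtain ⟨f', hf'⟩ := (f : D →ₗ[ℝ] ℝ).exists_extend
    have hf'φ : ∀ d, f' (φ d) = f d + f' x₀ := by
      intro d
      rw [hφ, map_add]; congr 1
      exact LinearMap.congr_fun hf' d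
    have hFexp : φ '' F₀ = {a ∈ R | ∀ c ∈ R, f' c ≤ f' a} := by
      rw [hf]
      ext w
      constructor
      · rintro ⟨a, ⟨ha, hmax⟩, rfl⟩
        refine ⟨ha, fun c hc => ?_⟩
        obtain ⟨c, rfl⟩ := hrange hc
        rw [hf'φ, hf'φ]; linarith [hmax c hc]
      · rintro ⟨ha, hmax⟩
        obtain ⟨a, rfl⟩ := hrange ha
        refine ⟨a, ⟨ha, fun c hc => ?_⟩, rfl⟩
        have := hmax _ hc
        rw [hf'φ, hf'φ] at this; linarith
    let F : facets R := ⟨φ '' F₀, fun _ => ⟨LinearMap.toContinuousLinearMap f', hFexp⟩,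
      ⟨_, z₀, hz₀, rfl⟩, by
        rw [← AffineMap.map_vectorSpan, hφl, Submodule.finrank_map_subtype_eq]
        exact hdim⟩
    have hgF := hg F
    -- The functional `g F` chosen for this facet need not be `f'`; the separation is available for
    -- every exposing functional.
    obtain ⟨z, hz, hlt⟩ := hsep ((g F).comp D.subtypeL) (by
      have hgφ : ∀ d : D, g F (φ d) = (g F).comp D.subtypeL d + g F x₀ := fun d => by
        rw [hφ, map_add]; rfl
      rw [← Set.preimage_image_eq F₀ hinj]
      change φ ⁻¹' (F : Set (Fin k → ℝ)) = _
      rw [hgF]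
      ext a
      refine and_congr_right fun _ => ⟨fun h c hc => ?_, fun h c hc => ?_⟩
      · have := h (φ c) hc
        rw [hgφ, hgφ] at this; linarith
      · obtain ⟨c, rfl⟩ := hrange hc
        rw [hgφ, hgφ]; linarith [h c hc])
    have h1 := hx.2 F
    have hzF : φ z ∈ {a ∈ R | ∀ c ∈ R, g F c ≤ g F a} := hgF ▸ ⟨z, hz, rfl⟩
    have hbR : b F ∈ R := F.2.1.subset (hb F)
    have h2 := hzF.2 _ hbR
    rw [hℓ, hφ, map_add] at h1
    rw [hφ, map_add] at h2
    simp only [ContinuousLinearMap.comp_apply, Submodule.subtypeL_apply] at hlt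
    linarith
  · rw [hℓ]; linarith [hgmax F _ hx]

/-! ### Pyramids and the distribution of inequalities -/

/-- The common zeros of a set of affine functionals in an affine subspace. -/
def AffineSubspace.zeros {V : Type*} [AddCommGroup V] [Module ℝ V] (A : AffineSubspace ℝ V)
    (S : Set (V →ᵃ[ℝ] ℝ)) : AffineSubspace ℝ V where
  carrier := {x | x ∈ A ∧ ∀ f ∈ S, f x = 0}
  smul_vsub_vadd_mem' c x y z hx hy hz :=
    ⟨A.smul_vsub_vadd_mem c hx.1 hy.1 hz.1, fun f hf => by
      rw [AffineMap.map_vadd, map_smul, AffineMap.linearMap_vsub, hx.2 f hf, hy.2 f hf, hz.2 f hf]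
      simp⟩

theorem AffineSubspace.mem_zeros {V : Type*} [AddCommGroup V] [Module ℝ V]
    {A : AffineSubspace ℝ V} {S : Set (V →ᵃ[ℝ] ℝ)} {x : V} :
    x ∈ A.zeros S ↔ x ∈ A ∧ ∀ f ∈ S, f x = 0 := Iff.rfl

/-- `P` is a pyramid with apex `v` over the non-empty base `{p ∈ P | a p = 0}`, where the affine
functional `a` takes the value `1` at the apex. -/
structure IsPyramidWith {E : Type*} [AddCommGroup E] [Module ℝ E] (P : Set E) (v : E)
    (a : E →ᵃ[ℝ] ℝ) : Prop where
  apex_mem : v ∈ P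
  apply_apex : a v = 1
  nonneg : ∀ p ∈ P, 0 ≤ a p
  base_nonempty : ∃ b ∈ P, a b = 0
  exists_base : ∀ p ∈ P, ∃ b ∈ P, a b = 0 ∧ ∃ t ∈ Set.Icc (0 : ℝ) 1, p = AffineMap.lineMap v b t
  mem_of_lineMap_mem : ∀ p, 0 ≤ a p → ∀ t : ℝ, 0 < t → AffineMap.lineMap v p t ∈ P → p ∈ P

theorem isPyramidWith_convexHull {E : Type*} [AddCommGroup E] [Module ℝ E] {B : Set E} {v : E}
    (hB : B.Nonempty) {a : E →ᵃ[ℝ] ℝ} (hav : a v = 1) (haB : ∀ b ∈ B, a b = 0) :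
    IsPyramidWith (convexHull ℝ (B ∪ {v})) v a := by
  have hconv := convex_convexHull ℝ (B ∪ {v})
  have hvP : v ∈ convexHull ℝ (B ∪ {v}) := subset_convexHull ℝ _ (Or.inr rfl)
  have hBP : convexHull ℝ B ⊆ convexHull ℝ (B ∪ {v}) := convexHull_mono Set.subset_union_left
  have haB' : ∀ b ∈ convexHull ℝ B, a b = 0 := fun b hb =>
    convexHull_min (t := a ⁻¹' {0}) haB ((convex_singleton (0 : ℝ)).affine_preimage a) hb
  have hjoin : ∀ p ∈ convexHull ℝ (B ∪ {v}), ∃ b ∈ convexHull ℝ B, ∃ t ∈ Set.Icc (0 : ℝ) 1,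
      p = AffineMap.lineMap v b t := by
    intro p hp
    rw [Set.union_singleton, convexHull_insert hB, mem_convexJoin] at hp
    obtain ⟨w, rfl, b, hb, hp⟩ := hp
    rw [segment_eq_image_lineMap] at hp
    obtain ⟨t, ht, rfl⟩ := hp
    exact ⟨b, hb, t, ht, rfl⟩
  have hat : ∀ b ∈ convexHull ℝ B, ∀ t : ℝ, a (AffineMap.lineMap v b t) = 1 - t := by
    intro b hb t
    rw [apply_lineMap_real, hav, haB' b hb]; ring
  refine ⟨hvP, hav, fun p hp => ?_, ?_, fun p hp => ?_, fun p hp s hs hmem => ?_⟩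
  · obtain ⟨b, hb, t, ht, rfl⟩ := hjoin p hp
    rw [hat b hb]; linarith [ht.2]
  · obtain ⟨b, hb⟩ := hB
    exact ⟨b, hBP (subset_convexHull ℝ _ hb), haB b hb⟩
  · obtain ⟨b, hb, t, ht, rfl⟩ := hjoin p hp
    exact ⟨b, hBP hb, haB' b hb, t, ht, rfl⟩
  · obtain ⟨b, hb, t, ht, he⟩ := hjoin _ hmem
    have hpe : p = AffineMap.lineMap v b (t / s) := by
      rw [AffineMap.lineMap_apply_module', AffineMap.lineMap_apply_module', add_left_inj] at he
      rw [AffineMap.lineMap_apply_module', div_eq_inv_mul, mul_smul, ← he, smul_smul,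
        inv_mul_cancel₀ hs.ne', one_smul, sub_add_cancel]
    -- Now `0 ≤ a p` reads `t / s ≤ 1`, which puts `p` back on the segment from `v` to `b`.
    rw [hpe, hat b hb] at hp
    rw [hpe]
    exact hconv.lineMap_mem hvP (hBP hb) ⟨div_nonneg ht.1 hs.le, by linarith⟩

theorem exists_affineMap_eq_one_of_notMem_affineSpan {E : Type*} [AddCommGroup E] [Module ℝ E]
    {B : Set E} {v : E} (hB : B.Nonempty) (hv : v ∉ affineSpan ℝ B) :
    ∃ a : E →ᵃ[ℝ] ℝ, a v = 1 ∧ ∀ b ∈ B, a b = 0 := by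
  obtain ⟨b₀, hb₀⟩ := hB
  have hnot : v - b₀ ∉ vectorSpan ℝ B := by
    intro h
    rw [← direction_affineSpan] at h
    have := AffineSubspace.vadd_mem_of_mem_direction h (mem_affineSpan ℝ hb₀)
    simp at this
    exact hv this
  obtain ⟨f, hfv, hf⟩ := Submodule.exists_le_ker_of_notMem hnot
  refine ⟨(f v - f b₀)⁻¹ • (f.toAffineMap - AffineMap.const ℝ E (f b₀)), ?_, fun b hb => ?_⟩
  · have : f v - f b₀ ≠ 0 := by rwa [← map_sub]
    simp [this]
  · have : f (b - b₀) = 0 := hf (vsub_mem_vectorSpan ℝ hb hb₀)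
    rw [map_sub] at this
    simp [this]

/-- The inequalities of an extension of a product with a pyramid can be distributed over extensions
of the two factors. -/
theorem HasPolyhedralExtension.exists_add_eq_of_isPyramidWith {E G : Type*} [AddCommGroup E]
    [Module ℝ E] [NormedAddCommGroup G] [NormedSpace ℝ G] {P : Set E} {Q : Set G} {v : E}
    {a : E →ᵃ[ℝ] ℝ} (hP : IsPyramidWith P v a) (hQne : Q.Nonempty) (hQc : IsClosed Q) {N : ℕ}
    (h : HasPolyhedralExtension (P ×ˢ Q) N) :
    ∃ N₁ N₂, N₁ + N₂ = N ∧ HasPolyhedralExtension P N₁ ∧ HasPolyhedralExtension Q N₂ := by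
  classical
  obtain ⟨V, _, _, A, ℓ, π, hπ⟩ := h
  let ρ : V →ᵃ[ℝ] E := (LinearMap.fst ℝ E G).toAffineMap.comp π
  let κ : V →ᵃ[ℝ] G := (LinearMap.snd ℝ E G).toAffineMap.comp π
  let α : V →ᵃ[ℝ] ℝ := a.comp ρ
  have hα : ∀ x, α x = a (ρ x) := fun x => rfl
  have hmem : ∀ x ∈ polyhedron A ℓ, ρ x ∈ P ∧ κ x ∈ Q := by
    intro x hx
    have : π x ∈ P ×ˢ Q := hπ ▸ ⟨x, hx, rfl⟩
    exact this
  have hsurj : ∀ p ∈ P, ∀ q ∈ Q, ∃ x ∈ polyhedron A ℓ, ρ x = p ∧ κ x = q := by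
    intro p hp q hq
    have : (p, q) ∈ π '' polyhedron A ℓ := hπ ▸ ⟨hp, hq⟩
    obtain ⟨x, hx, hxe⟩ := this
    exact ⟨x, hx, congrArg Prod.fst hxe, congrArg Prod.snd hxe⟩
  have hconv := convex_polyhedron A ℓ
  obtain ⟨q₀, hq₀⟩ := hQne
  obtain ⟨b₀, hb₀, hab₀⟩ := hP.base_nonempty
  obtain ⟨y, ⟨hyR, hyv⟩, hypos⟩ := (hconv.inter
    ((convex_singleton v).affine_preimage ρ)).exists_forall_pos
    (by obtain ⟨x, hx, h1, _⟩ := hsurj v hP.apex_mem q₀ hq₀; exact ⟨x, hx, h1⟩) ℓ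
    fun x hx => hx.1.2
  replace hyv : ρ y = v := hyv
  have hI : ∀ i, ℓ i y = 0 → ∀ x ∈ polyhedron A ℓ, ρ x = v → ℓ i x = 0 := by
    intro i hi x hx hxv
    by_contra hc
    exact (hypos i ⟨x, ⟨hx, hxv⟩, lt_of_le_of_ne (hx.2 i) (Ne.symm hc)⟩).ne' hi
  have hcone : ∀ x ∈ A, (∀ i, ℓ i y = 0 → 0 ≤ ℓ i x) → 0 ≤ α x → ρ x ∈ P := by
    intro x hxA hx hαx
    obtain ⟨δ, hδ, _, hδR⟩ := exists_forall_lineMap_mem_polyhedron hyR hxA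
    have := (hmem _ (hδR δ (abs_of_pos hδ).le fun i hi => mul_nonneg hδ.le (hx i hi))).1
    rw [AffineMap.apply_lineMap, hyv] at this
    exact hP.mem_of_lineMap_mem _ hαx δ hδ this
  have hcard : Fintype.card {i // ℓ i y = 0} + Fintype.card {i // ¬ ℓ i y = 0} = N := by
    rw [Fintype.card_subtype_compl, Fintype.card_fin]
    have := Fintype.card_subtype_le (fun i => ℓ i y = 0)
    rw [Fintype.card_fin] at this
    omega
  -- Can an inequality active over the apex be made an equation without losing the base over some
  -- fixed `q`?
  by_cases hcase : ∃ i, ℓ i y = 0 ∧ ∃ q ∈ Q, ∀ x ∈ polyhedron A ℓ, α x = 0 → κ x = q → ℓ i x = 0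
  · obtain ⟨i₀, hi₀, q, hq, hvan⟩ := hcase
    refine ⟨_, _, hcard, ?_, ?_⟩
    -- The inequality `i₀` becomes an equation, and its place in the count is taken by `α ≥ 0`.
    · let ℓ' : Option {i : {i // ℓ i y = 0} // i ≠ ⟨i₀, hi₀⟩} → V →ᵃ[ℝ] ℝ :=
        fun o => o.elim α fun i => ℓ i.1
      refine .of_fintype (A.zeros {ℓ i₀}) ℓ' ρ ?_ ?_
      · refine Set.Subset.antisymm ?_ fun p hp => ?_
        · rintro _ ⟨x, hx, rfl⟩
          obtain ⟨hxA, hxz⟩ := AffineSubspace.mem_zeros.1 hx.1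
          refine hcone x hxA (fun i hi => ?_) (hx.2 none)
          by_cases hii : i = i₀
          · rw [hii, hxz _ rfl]
          · exact hx.2 (some ⟨⟨i, hi⟩, fun he => hii (congrArg Subtype.val he)⟩)
        · obtain ⟨b, hb, hab, t, ht, rfl⟩ := hP.exists_base p hp
          obtain ⟨x, hx, hxb, hxq⟩ := hsurj b hb q hq
          have hz := hconv.lineMap_mem hyR hx ht
          refine ⟨AffineMap.lineMap y x t, ⟨AffineSubspace.mem_zeros.2 ⟨hz.1, ?_⟩, ?_⟩, ?_⟩
          · rintro _ rfl
            rw [apply_lineMap_real, hi₀, hvan x hx (by rw [hα, hxb, hab]) hxq]; ring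
          · rintro (_ | i)
            · exact hP.nonneg _ (hmem _ hz).1
            · exact hz.2 _
          · rw [AffineMap.apply_lineMap, hyv, hxb]
      · rw [Fintype.card_option, Fintype.card_subtype_compl, Fintype.card_subtype_eq]
        have : 0 < Fintype.card {i // ℓ i y = 0} := Fintype.card_pos_iff.2 ⟨⟨i₀, hi₀⟩⟩
        omega
    · refine .of_fintype (A.zeros (ℓ '' {i | ℓ i y = 0})) (fun i : {i // ¬ ℓ i y = 0} => ℓ i) κ ?_
        le_rfl
      refine Set.Subset.antisymm ?_ fun q hq => ?_
      · rintro _ ⟨x, hx, rfl⟩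
        obtain ⟨hxA, hxz⟩ := AffineSubspace.mem_zeros.1 hx.1
        refine (hmem x ⟨hxA, fun i => ?_⟩).2
        by_cases hi : ℓ i y = 0
        · exact (hxz _ ⟨i, hi, rfl⟩).ge
        · exact hx.2 ⟨i, hi⟩
      · obtain ⟨x, hx, hxv, hxq⟩ := hsurj v hP.apex_mem q hq
        refine ⟨x, ⟨AffineSubspace.mem_zeros.2 ⟨hx.1, ?_⟩, fun i => hx.2 i⟩, hxq⟩
        rintro _ ⟨i, hi, rfl⟩
        exact hI i hi x hx hxv
  · push Not at hcase
    obtain ⟨j, hj⟩ : ∃ j, ∀ x ∈ polyhedron A ℓ, α x = 0 → ℓ j x = 0 := by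
      obtain ⟨z, ⟨hzR, hz0⟩, hzpos⟩ := (hconv.inter
        ((convex_singleton (0 : ℝ)).affine_preimage α)).exists_forall_pos
        (by
          obtain ⟨x, hx, h1, _⟩ := hsurj b₀ hb₀ q₀ hq₀
          exact ⟨x, hx, by rw [Set.mem_preimage, hα, h1, hab₀]; rfl⟩) ℓ
        fun x hx => hx.1.2
      replace hz0 : α z = 0 := hz0
      obtain ⟨j, hjz⟩ : ∃ j, ℓ j z = 0 := by
        by_contra! hcon
        -- With no inequality active at `z`, one could step from `z` away from `y`, making `α`
        -- negative.
        obtain ⟨δ, hδ, _, hδR⟩ := exists_forall_lineMap_mem_polyhedron hzR hyR.1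
        have := hP.nonneg _ (hmem _ (hδR (-δ) (by rw [abs_neg, abs_of_pos hδ])
          fun i hi => absurd hi (hcon i))).1
        rw [← hα, apply_lineMap_real, hz0, hα, hyv, hP.apply_apex] at this
        linarith
      refine ⟨j, fun x hx hx0 => ?_⟩
      by_contra hc
      exact (hzpos j ⟨x, ⟨hx, hx0⟩, lt_of_le_of_ne (hx.2 j) (Ne.symm hc)⟩).ne' hjz
    have hjy : ¬ ℓ j y = 0 := by
      intro hjy
      obtain ⟨x, hx, hx0, _, hne⟩ := hcase j hjy q₀ hq₀
      exact hne (hj x hx hx0)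
    have hpos : 0 < Fintype.card {i // ¬ ℓ i y = 0} := Fintype.card_pos_iff.2 ⟨⟨j, hjy⟩⟩
    refine ⟨Fintype.card {i // ℓ i y = 0} + 1, Fintype.card {i // ¬ ℓ i y = 0} - 1, by omega,
      ?_, ?_⟩
    · let ℓ' : Option {i // ℓ i y = 0} → V →ᵃ[ℝ] ℝ := fun o => o.elim α fun i => ℓ i.1
      refine .of_fintype A ℓ' ρ ?_ (by rw [Fintype.card_option])
      refine Set.Subset.antisymm ?_ fun p hp => ?_
      · rintro _ ⟨x, hx, rfl⟩
        exact hcone x hx.1 (fun i hi => hx.2 (some ⟨i, hi⟩)) (hx.2 none)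
      · obtain ⟨x, hx, hxp, _⟩ := hsurj p hp q₀ hq₀
        refine ⟨x, ⟨hx.1, ?_⟩, hxp⟩
        rintro (_ | i)
        · exact hP.nonneg _ (hmem _ hx).1
        · exact hx.2 _
    · refine .of_fintype (A.zeros {ℓ j})
        (fun i : {i : {i // ¬ ℓ i y = 0} // i ≠ ⟨j, hjy⟩} => ℓ i.1) κ ?_
        (by rw [Fintype.card_subtype_compl, Fintype.card_subtype_eq])
      refine Set.Subset.antisymm ?_ fun q hq => ?_
      · rintro _ ⟨x, hx, rfl⟩
        obtain ⟨hxA, hxz⟩ := AffineSubspace.mem_zeros.1 hx.1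
        by_contra hxQ
        -- A short step towards `x` from a relative interior point `z` of the fibre over base ×
        -- `{q}` will go beyond this last point `q` while staying over `Q`.
        obtain ⟨t, ht0, ht1, htQ, hlast⟩ := hQc.exists_last_lineMap_mem hq₀ hxQ
        set q := (AffineMap.lineMap q₀ (κ x) t : G) with hq
        obtain ⟨z, ⟨⟨hzR, hz0⟩, hzq⟩, hzpos⟩ := ((hconv.inter
          ((convex_singleton (0 : ℝ)).affine_preimage α)).inter
          ((convex_singleton q).affine_preimage κ)).exists_forall_pos
          (by
            obtain ⟨x, hx, h1, h2⟩ := hsurj b₀ hb₀ q htQ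
            exact ⟨x, ⟨hx, by rw [Set.mem_preimage, hα, h1, hab₀]; rfl⟩, h2⟩) ℓ
          fun x hx => hx.1.1.2
        replace hzq : κ z = q := hzq
        obtain ⟨δ, hδ, hδ1, hδR⟩ := exists_forall_lineMap_mem_polyhedron hzR hxA
        have hmemQ := (hmem _ (hδR δ (abs_of_pos hδ).le fun i hi => mul_nonneg hδ.le ?_)).2
        · have he : κ (AffineMap.lineMap z x δ) =
              AffineMap.lineMap q₀ (κ x) (t + δ * (1 - t)) := by
            rw [AffineMap.apply_lineMap, hzq, hq]
            simp only [AffineMap.lineMap_apply_module]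
            module
          rw [he] at hmemQ
          exact hlast _ (by nlinarith) (by nlinarith) hmemQ
        -- At `x`, the inequality `j` is an equation and those outside `I` hold; those in `I` are
        -- strict at `z` by the case assumption, hence not active.
        · by_cases hij : i = j
          · rw [hij, hxz _ rfl]
          · by_cases hiy : ℓ i y = 0
            · obtain ⟨w, hw, hw0, hwq, hwne⟩ := hcase i hiy q htQ
              exact absurd hi (hzpos i ⟨w, ⟨⟨hw, hw0⟩, hwq⟩,
                lt_of_le_of_ne (hw.2 i) (Ne.symm hwne)⟩).ne'
            · exact hx.2 ⟨⟨i, hiy⟩, fun he => hij (congrArg Subtype.val he)⟩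
      · obtain ⟨x, hx, hxb, hxq⟩ := hsurj b₀ hb₀ q hq
        refine ⟨x, ⟨AffineSubspace.mem_zeros.2 ⟨hx.1, ?_⟩, fun i => hx.2 _⟩, hxq⟩
        rintro _ rfl
        exact hj x hx (by rw [hα, hxb, hab₀])

/-! ### Extension complexity of products -/

theorem HasPolyhedralExtension.prod {E G : Type*} [AddCommGroup E] [Module ℝ E] [AddCommGroup G]
    [Module ℝ G] {P : Set E} {Q : Set G} {M N : ℕ} (hP : HasPolyhedralExtension P M)
    (hQ : HasPolyhedralExtension Q N) : HasPolyhedralExtension (P ×ˢ Q) (M + N) := by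
  obtain ⟨V, _, _, A, ℓ, π, rfl⟩ := hP
  obtain ⟨W, _, _, A', ℓ', π', rfl⟩ := hQ
  let f : V × W →ᵃ[ℝ] V := (LinearMap.fst ℝ V W).toAffineMap
  let g : V × W →ᵃ[ℝ] W := (LinearMap.snd ℝ V W).toAffineMap
  refine .of_fintype (A.comap f ⊓ A'.comap g)
    (Sum.elim (fun i => (ℓ i).comp f) fun j => (ℓ' j).comp g) ((π.comp f).prod (π'.comp g)) ?_
    (by simp)
  ext ⟨p, q⟩
  constructor
  · rintro ⟨⟨x, y⟩, ⟨hA, h⟩, he⟩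
    exact ⟨⟨x, ⟨hA.1, fun i => h (.inl i)⟩, congrArg Prod.fst he⟩,
      ⟨y, ⟨hA.2, fun j => h (.inr j)⟩, congrArg Prod.snd he⟩⟩
  · rintro ⟨⟨x, hx, rfl⟩, y, hy, rfl⟩
    refine ⟨(x, y), ⟨⟨hx.1, hy.1⟩, ?_⟩, rfl⟩
    rintro (i | j)
    · exact hx.2 i
    · exact hy.2 j

theorem HasPolyhedralExtension.image {E G : Type*} [AddCommGroup E] [Module ℝ E] [AddCommGroup G]
    [Module ℝ G] {P : Set E} {N : ℕ} (hP : HasPolyhedralExtension P N) (f : E →ᵃ[ℝ] G) :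
    HasPolyhedralExtension (f '' P) N := by
  obtain ⟨V, _, _, A, ℓ, π, rfl⟩ := hP
  exact ⟨V, _, _, A, ℓ, f.comp π, by rw [AffineMap.coe_comp, Set.image_comp]⟩

theorem HasPolyhedralExtension.extensionComplexity_le {E : Type*} [NormedAddCommGroup E]
    [NormedSpace ℝ E] {P : Set E} {N : ℕ} (h : HasPolyhedralExtension P N) (hne : P.Nonempty)
    (hb : Bornology.IsBounded P) : extensionComplexity P ≤ N := by
  obtain ⟨r, hr, hmem⟩ := h.exists_polytope hne hb
  exact (Nat.sInf_le hmem).trans hr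

/-- The extension complexity is attained by some extension. -/
theorem HasPolyhedralExtension.hasPolyhedralExtension_extensionComplexity {E : Type*}
    [NormedAddCommGroup E] [NormedSpace ℝ E] {P : Set E} {N : ℕ} (h : HasPolyhedralExtension P N)
    (hne : P.Nonempty) (hb : Bornology.IsBounded P) :
    HasPolyhedralExtension P (extensionComplexity P) := by
  -- Some extension must exist before the infimum is attained, since `sInf ∅ = 0`.
  obtain ⟨r, _, hmem⟩ := h.exists_polytope hne hb
  obtain ⟨k, R, π, hR, hπ, hcard⟩ := Nat.sInf_mem (s := {r : ℕ | ∃ (k : ℕ) (R : Set (Fin k → ℝ))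
    (π : (Fin k → ℝ) →ᵃ[ℝ] E), IsPolytope R ∧ π '' R = P ∧ (facets R).encard = (r : ℕ∞)}) ⟨r, hmem⟩
  have hRne : R.Nonempty := by rw [← hπ] at hne; exact hne.of_image
  have := hR.hasPolyhedralExtension_image hRne π
  rw [hπ, Set.ncard, hcard, ENat.toNat_natCast] at this
  exact this

theorem IsPolytope.hasPolyhedralExtension_extensionComplexity {m : ℕ} {P : Set (Fin m → ℝ)}
    (hP : IsPolytope P) (hne : P.Nonempty) : HasPolyhedralExtension P (extensionComplexity P) := by
  have h := hP.hasPolyhedralExtension_image hne (AffineMap.id ℝ _)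
  rw [AffineMap.coe_id, Set.image_id] at h
  exact h.hasPolyhedralExtension_extensionComplexity hne hP.isCompact.isBounded

theorem hasPolyhedralExtension_singleton {E : Type*} [AddCommGroup E] [Module ℝ E] (v : E) :
    HasPolyhedralExtension {v} 0 :=
  ⟨ℝ, _, _, ⊤, Fin.elim0, AffineMap.const ℝ ℝ v, by
    ext w
    constructor
    · rintro ⟨_, _, rfl⟩; rfl
    · rintro rfl
      exact ⟨0, ⟨trivial, fun i => i.elim0⟩, rfl⟩⟩

theorem extensionComplexity_add_le_of_isPyramid {E G : Type*} [NormedAddCommGroup E]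
    [NormedSpace ℝ E] [NormedAddCommGroup G] [NormedSpace ℝ G] {P : Set E} {Q : Set G}
    (hP : IsPyramid P) (hPb : Bornology.IsBounded P) (hPne : P.Nonempty) (hQ : IsCompact Q)
    (hQne : Q.Nonempty) {N : ℕ} (h : HasPolyhedralExtension (P ×ˢ Q) N) :
    extensionComplexity P + extensionComplexity Q ≤ N := by
  obtain ⟨B, v, rfl, hv⟩ := hP
  obtain ⟨N₁, N₂, rfl, h₁, h₂⟩ : ∃ N₁ N₂, N₁ + N₂ = N ∧
      HasPolyhedralExtension (convexHull ℝ (B ∪ {v})) N₁ ∧ HasPolyhedralExtension Q N₂ := by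
    -- A pyramid over the empty base is a point, which costs no inequality; all of them go to `Q`.
    rcases B.eq_empty_or_nonempty with rfl | hB
    · refine ⟨0, N, zero_add N, ?_, ?_⟩
      · rw [Set.empty_union, convexHull_singleton]
        exact hasPolyhedralExtension_singleton v
      · have := h.image (LinearMap.snd ℝ E G).toAffineMap
        rwa [LinearMap.coe_toAffineMap, LinearMap.coe_snd, Set.snd_image_prod hPne] at this
    · obtain ⟨a, hav, haB⟩ := exists_affineMap_eq_one_of_notMem_affineSpan hB hv
      exact h.exists_add_eq_of_isPyramidWith (isPyramidWith_convexHull hB hav haB) hQne hQ.isClosed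
  exact add_le_add (h₁.extensionComplexity_le hPne hPb) (h₂.extensionComplexity_le hQne hQ.isBounded)

theorem theorem1 (m n : ℕ) (P : Set (Fin m → ℝ)) (Q : Set (Fin n → ℝ))
    (hP : IsPolytope P) (hQ : IsPolytope Q) (hPne : P.Nonempty) (hQne : Q.Nonempty)
    (hpyr : IsPyramid P ∨ IsPyramid Q) :
    extensionComplexity (P ×ˢ Q) = extensionComplexity P + extensionComplexity Q := by
  have hPc := hP.isCompact
  have hQc := hQ.isCompact
  have hprod := (hP.hasPolyhedralExtension_extensionComplexity hPne).prod
    (hQ.hasPolyhedralExtension_extensionComplexity hQne)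
  have hne := hPne.prod hQne
  have hb := hPc.isBounded.prod hQc.isBounded
  refine le_antisymm (hprod.extensionComplexity_le hne hb) ?_
  have hmin := hprod.hasPolyhedralExtension_extensionComplexity hne hb
  rcases hpyr with h | h
  · exact extensionComplexity_add_le_of_isPyramid h hPc.isBounded hPne hQc hQne hmin
  · have hswap := hmin.image (LinearEquiv.prodComm ℝ (Fin m → ℝ) (Fin n → ℝ)).toLinearMap.toAffineMap
    have he : (LinearEquiv.prodComm ℝ (Fin m → ℝ) (Fin n → ℝ)).toLinearMap.toAffineMap ''
        (P ×ˢ Q) = Q ×ˢ P := Set.image_swap_prod P Q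
    rw [he] at hswap
    rw [add_comm]
    exact extensionComplexity_add_le_of_isPyramid h hQc.isBounded hQne hPc hPne hswap
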